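/- **Fractional derivatives.** All integrals $\int_0^\infty$ below are improper: $\int_0^\infty g=\lim_{R\to\infty}\int_0^R g$, with $g$ Lebesgue integrable on each $[0,R]$. For $r\in\mathbb R$ put $n_r=\max(\lceil r\rceil,0)$. The $r$-th (Liouville–Weyl) fractional derivative of $f$ at $t$ is $$f^{(r)}(t)=\frac{1}{\Gamma(n_r-r)}\int_0^\infty u^{\,n_r-r-1}\,\frac{d^{n_r}f}{dt^{n_r}}(t-u)\,du\quad (r\notin\{0,1,2,\dots\}),$$ whenever this integral converges, and $f^{(r)}$ is the ordinary derivative of order $r$ if $r\in\{0,1,2,\dots\}$. In particular, for $r<0$ it is the fractional integral $\frac1{\Gamma(-r)}\int_0^\infty u^{-r-1}f(t-u)\,du$. **Theorem 2.3.** Let $s>0$, $k>0$ and $r,a\in\mathbb R$, and put $n=n_r$ and $m=n_{r-s/k}\le n$. Let $f$ be a complex-valued function that is $n$ times continuously differentiable in a neighbourhood of $(-\infty,a]$. Suppose that the integral $$\int_0^\infty u^{\,n-r+\frac sk-1}f^{(n)}(a-u)\,du$$ converges and that $f^{(j)}(x)\to0$ as $x\to-\infty$ for every integer $j$ with $m\le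 j<n$. Then $f^{(r)}(t)$ exists for every $t\le a$, $f^{(r-s/k)}(a)$ exists, and the integral on the left below converges, with $$\int_0^\infty x^{s-1} f^{(r)}\!\left(a-\frac{x^k}{k}\right)dx=k^{\frac sk-1}\,\Gamma\!\left(\frac sk\right) f^{\left(r-\frac sk\right)}(a).$$ -/

import Mathlib

open Filter Topology MeasureTheory

/-- The improper integral `∫_0^∞ g` converges to `L`: `g` is integrable on every `[0, R]` and
`∫_0^R g → L` as `R → ∞` (absolute convergence at infinity is not required). -/
def HasImproperIntegral (g : ℝ → ℂ) (L : ℂ) : Prop :=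
  (∀ R : ℝ, 0 < R → IntervalIntegrable g volume 0 R) ∧
    Tendsto (fun R : ℝ => ∫ x in (0 : ℝ)..R, g x) atTop (𝓝 L)

/-- The improper integral `∫_0^∞ g` converges. -/
def ImproperConverges (g : ℝ → ℂ) : Prop :=
  ∃ L : ℂ, HasImproperIntegral g L

/-- The value `lim_{R → ∞} ∫_0^R g` of the improper integral (meaningful when it converges). -/
noncomputable def improperIntegral (g : ℝ → ℂ) : ℂ :=
  limUnder atTop (fun R : ℝ => ∫ x in (0 : ℝ)..R, g x)

/-- The integrand `u ↦ u^(α-1) g(t-u)` of the Liouville-Weyl fractional integral of order `α`. -/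
noncomputable def weylIntegrand (α : ℝ) (g : ℝ → ℂ) (t : ℝ) : ℝ → ℂ :=
  fun u => ((u ^ (α - 1) : ℝ) : ℂ) * g (t - u)

/-- The Liouville-Weyl fractional integral of order `α ≥ 0` (lower terminal `-∞`):
`g t` for `α = 0`, and `(1/Γ(α)) ∫_0^∞ u^(α-1) g(t-u) du` for `α > 0`. -/
noncomputable def weylIntegral (α : ℝ) (g : ℝ → ℂ) (t : ℝ) : ℂ :=
  if α = 0 then g t
  else ((Real.Gamma α : ℝ) : ℂ)⁻¹ * improperIntegral (weylIntegrand α g t)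

/-- The Liouville-Weyl fractional derivative `f^(r)(t)` of real order `r`: with `n = max(⌈r⌉, 0)`,
the fractional integral of order `n - r ≥ 0` of the ordinary derivative `f^(n)`.
For `r = n` a natural number it is the ordinary `n`-th derivative, and for `r < 0` it is the
fractional integral of order `-r` of `f`. -/
noncomputable def fracDeriv (r : ℝ) (f : ℝ → ℂ) (t : ℝ) : ℂ :=
  weylIntegral ((⌈r⌉₊ : ℝ) - r) (iteratedDeriv ⌈r⌉₊ f) t

/-- The integral that defines `f^(r)(t)` converges (no condition if `r` is a natural number, where
no integral occurs). -/
def FracDerivConverges (r : ℝ) (f : ℝ → ℂ) (t : ℝ) : Prop :=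
  (⌈r⌉₊ : ℝ) - r = 0 ∨
    ImproperConverges (weylIntegrand ((⌈r⌉₊ : ℝ) - r) (iteratedDeriv ⌈r⌉₊ f) t)

/-!
# Power moments of Liouville–Weyl fractional derivatives

Write `g u = f⁽ⁿ⁾(a - u)`, `α = n - r ≥ 0`, `σ = s / k` and
`W_α g (y) = Γ(α)⁻¹ ∫_0^∞ u^(α-1) g (y + u) du`, so that `f^(r)(a - y) = W_α g (y)`. The substitution
`y = x ^ k / k` (`HasImproperIntegral.comp_rpow_div`) turns the claim into
`∫_0^∞ y^(σ-1) W_α g (y) dy = Γ(σ) f^(r-σ)(a)`, and this has two halves.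

* The semigroup law `∫_0^∞ y^(σ-1) W_α g (y) dy = Γ(σ) W_(α+σ) g (0)`
  (`hasImproperIntegral_rpow_mul_weylIntegral`). Formally it is Fubini's theorem together with the
  beta integral, but `h v = v^(α+σ-1) g v` is only conditionally integrable. With `y` cut off at `Y`
  and `v = y + u` cut off at `N`, Fubini's theorem applies and gives
  `∫_0^N b(min 1 (Y/v)) h v dv` with `b` the incomplete beta function
  (`integral_rpow_mul_weyl_swap`). The weight `b(min 1 (Y/v))` is the full beta integral for `v ≤ Y`
  and decreases afterwards, so its contribution from `[Y, N]` is controlled by the tails of `∫ h`.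
  The cutoff `N` is removed by tail estimates for `W_α g (y)`, uniform in `y ∈ [0, Y]`
  (`HasImproperIntegral.exists_weylIntegrand_tail_le`), which also give the existence of `f^(r)`.
* The identity `W_(α+σ) g (0) = f^(r-σ)(a)` (`fracDeriv_eq_weylIntegral_of_le`), by repeated
  integration by parts. The boundary terms vanish because the lower derivatives tend to `0`,
  at a rate forced by the convergence of the integral
  (`HasImproperIntegral.tendsto_rpow_mul_primitive`).

Every estimate on a conditionally convergent integral comes from one inequality, in the spirit of
the second mean value theorem: a nonnegative decreasing weight `w` on `[A, B]` satisfies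
`‖∫_A^B w h‖ ≤ w A * sup_x ‖∫_A^x h‖` (`norm_integral_antitoneOn_mul_le`).
-/

/-! ### Second mean value estimates and improper integrals -/

/-- A superlevel set of a decreasing weight in `(A, B]` is, up to a null set, an interval with left
endpoint `A`, so bounds on `∫_A^x h` pass to it. -/
theorem norm_setIntegral_superlevel_le {A B : ℝ} {w : ℝ → ℝ} (hw : Antitone w) {h : ℝ → ℂ}
    {ε : ℝ} (hε0 : 0 ≤ ε) (hε : ∀ x ∈ Set.Icc A B, ‖∫ v in A..x, h v‖ ≤ ε) (t : ℝ) :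
    ‖∫ v in Set.Ioc A B ∩ {v | t ≤ w v}, h v‖ ≤ ε := by
  set S := Set.Ioc A B ∩ {v | t ≤ w v} with hS
  rcases S.eq_empty_or_nonempty with h0 | hne
  · simpa [h0] using hε0
  have hbdd : BddAbove S := ⟨B, fun v hv => hv.1.2⟩
  obtain ⟨v₀, hv₀⟩ := hne
  have hA : A ≤ sSup S := hv₀.1.1.le.trans (le_csSup hbdd hv₀)
  have hB : sSup S ≤ B := csSup_le ⟨v₀, hv₀⟩ fun v hv => hv.1.2
  have hsub : Set.Ioo A (sSup S) ⊆ S := by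
    intro v hv
    obtain ⟨z, hz, hvz⟩ := exists_lt_of_lt_csSup ⟨v₀, hv₀⟩ hv.2
    exact ⟨⟨hv.1, hvz.le.trans hz.1.2⟩, le_trans hz.2 (hw hvz.le)⟩
  have hsup : S ⊆ Set.Ioc A (sSup S) := fun v hv => ⟨hv.1.1, le_csSup hbdd hv⟩
  have hae : S =ᵐ[volume] Set.Ioc A (sSup S) := by
    refine Filter.EventuallyLE.antisymm hsup.eventuallyLE ?_
    exact (Ioo_ae_eq_Ioc (μ := volume)).symm.le.trans hsub.eventuallyLE
  rw [setIntegral_congr_set hae, ← intervalIntegral.integral_of_le hA]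
  exact hε _ ⟨hA, hB⟩

/-- The bound of the second mean value theorem, for complex values and without regularity of `w`:
write `w v = ∫_0^{w A} 1[t ≤ w v] dt` and exchange the integrals. -/
theorem norm_integral_antitone_mul_le {A B : ℝ} (hAB : A ≤ B) {w : ℝ → ℝ} (hw : Antitone w)
    (h0 : ∀ x, 0 ≤ w x) {h : ℝ → ℂ} (hh : IntervalIntegrable h volume A B) {ε : ℝ}
    (hε : ∀ x ∈ Set.Icc A B, ‖∫ v in A..x, h v‖ ≤ ε) :
    ‖∫ v in A..B, ((w v : ℝ) : ℂ) * h v‖ ≤ w A * ε := by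
  have hε0 : 0 ≤ ε := (norm_nonneg _).trans (hε A ⟨le_rfl, hAB⟩)
  rw [intervalIntegrable_iff_integrableOn_Ioc_of_le hAB] at hh
  set D : Set (ℝ × ℝ) := {p | p.2 ≤ w p.1}
  have hD : MeasurableSet D := measurableSet_le measurable_snd (hw.measurable.comp measurable_fst)
  have hF : Integrable (D.indicator fun p : ℝ × ℝ => h p.1)
      ((volume.restrict (Set.Ioc A B)).prod (volume.restrict (Set.Ioc 0 (w A)))) := by
    refine Integrable.indicator ?_ hD
    have : Integrable (fun _ : ℝ => (1 : ℂ)) (volume.restrict (Set.Ioc 0 (w A))) :=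
      integrable_const _
    simpa using hh.mul_prod this
  have hleft : ∫ v in A..B, ((w v : ℝ) : ℂ) * h v =
      ∫ v in Set.Ioc A B, ∫ t in Set.Ioc 0 (w A), D.indicator (fun p : ℝ × ℝ => h p.1) (v, t) := by
    rw [intervalIntegral.integral_of_le hAB]
    refine setIntegral_congr_fun measurableSet_Ioc fun v hv => ?_
    have hwv : w v ≤ w A := hw hv.1.le
    have : (fun t => D.indicator (fun p : ℝ × ℝ => h p.1) (v, t)) =
        (Set.Iic (w v)).indicator fun _ => h v := by
      ext t
      simp [D, Set.indicator]
    simp only [this]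
    rw [setIntegral_indicator measurableSet_Iic, Set.Ioc_inter_Iic, min_eq_right hwv]
    simp [h0 v]
  rw [hleft, integral_integral_swap (f := fun v t => D.indicator (fun p : ℝ × ℝ => h p.1) (v, t)) hF]
  refine (norm_setIntegral_le_of_norm_le_const (C := ε) (by simp) fun t _ => ?_).trans ?_
  · have : (fun v => D.indicator (fun p : ℝ × ℝ => h p.1) (v, t)) =
        {v | t ≤ w v}.indicator h := by
      ext v
      simp [D, Set.indicator]
    rw [this, setIntegral_indicator (measurableSet_le measurable_const hw.measurable)]
    exact norm_setIntegral_superlevel_le hw hε0 hε t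
  · simp [h0 A, mul_comm]

/-- `norm_integral_antitone_mul_le` for a weight that is nonnegative and decreasing on `[A, B]`
only. -/
theorem norm_integral_antitoneOn_mul_le {A B : ℝ} (hAB : A ≤ B) {w : ℝ → ℝ}
    (hw : AntitoneOn w (Set.Icc A B)) (h0 : ∀ x ∈ Set.Icc A B, 0 ≤ w x) {h : ℝ → ℂ}
    (hh : IntervalIntegrable h volume A B) {ε : ℝ}
    (hε : ∀ x ∈ Set.Icc A B, ‖∫ v in A..x, h v‖ ≤ ε) :
    ‖∫ v in A..B, ((w v : ℝ) : ℂ) * h v‖ ≤ w A * ε := by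
  have hmem : ∀ x, max A (min B x) ∈ Set.Icc A B := fun x =>
    ⟨le_max_left _ _, max_le hAB (min_le_left _ _)⟩
  -- Extend the weight constantly outside `[A, B]`.
  have key := norm_integral_antitone_mul_le hAB (w := fun x => w (max A (min B x)))
    (fun x y hxy => hw (hmem x) (hmem y) (max_le_max le_rfl (min_le_min le_rfl hxy)))
    (fun x => h0 _ (hmem x)) hh hε
  have hA : max A (min B A) = A := by simp
  simp only [hA] at key
  refine le_of_eq_of_le (congrArg _ (intervalIntegral.integral_congr fun v hv => ?_)) key
  rw [Set.uIcc_of_le hAB] at hv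
  simp [hv.1, hv.2]

theorem HasImproperIntegral.exists_norm_integral_le {h : ℝ → ℂ} {L : ℂ}
    (hh : HasImproperIntegral h L) {ε : ℝ} (hε : 0 < ε) :
    ∃ N₀ : ℝ, 0 < N₀ ∧ ∀ N M : ℝ, N₀ ≤ N → N ≤ M → ‖∫ v in N..M, h v‖ ≤ ε := by
  obtain ⟨N₁, hN₁⟩ := (Metric.tendsto_atTop.1 hh.2) (ε / 2) (half_pos hε)
  refine ⟨max N₁ 1, by positivity, fun N M hN hM => ?_⟩
  have hN0 : 0 < N := lt_of_lt_of_le (by positivity) hN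
  rw [← intervalIntegral.integral_interval_sub_left (hh.1 M (hN0.trans_le hM)) (hh.1 N hN0),
    ← dist_eq_norm]
  have h1 := hN₁ N ((le_max_left _ _).trans hN)
  have h2 := hN₁ M ((le_max_left _ _).trans (hN.trans hM))
  have := dist_triangle_right (∫ v in (0:ℝ)..M, h v) (∫ v in (0:ℝ)..N, h v) L
  linarith

/-- The Cauchy criterion for improper integrals. -/
theorem improperConverges_of_tail {h : ℝ → ℂ}
    (hi : ∀ R : ℝ, 0 < R → IntervalIntegrable h volume 0 R)
    (ht : ∀ ε : ℝ, 0 < ε → ∃ N₀ : ℝ, 0 < N₀ ∧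
      ∀ N M : ℝ, N₀ ≤ N → N ≤ M → ‖∫ v in N..M, h v‖ ≤ ε) :
    ImproperConverges h := by
  have hc : Cauchy (map (fun R : ℝ => ∫ v in (0 : ℝ)..R, h v) atTop) := by
    rw [Metric.cauchy_iff]
    refine ⟨inferInstance, fun ε hε => ?_⟩
    obtain ⟨N₀, hN₀, hN⟩ := ht (ε / 4) (by positivity)
    refine ⟨_, image_mem_map (Ici_mem_atTop N₀), ?_⟩
    have key : ∀ M, N₀ ≤ M → dist (∫ v in (0 : ℝ)..M, h v) (∫ v in (0 : ℝ)..N₀, h v) ≤ ε / 4 := by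
      intro M hM
      rw [dist_eq_norm, intervalIntegral.integral_interval_sub_left (hi M (hN₀.trans_le hM))
        (hi N₀ hN₀)]
      exact hN N₀ M le_rfl hM
    rintro _ ⟨x, hx, rfl⟩ _ ⟨y, hy, rfl⟩
    have := dist_triangle_right (∫ v in (0 : ℝ)..x, h v) (∫ v in (0 : ℝ)..y, h v)
      (∫ v in (0 : ℝ)..N₀, h v)
    have h1 := key x hx
    have h2 := key y hy
    simp only
    linarith
  obtain ⟨L, hL⟩ := cauchy_map_iff_exists_tendsto.1 hc
  exact ⟨L, hi, hL⟩

theorem HasImproperIntegral.improperIntegral_eq {h : ℝ → ℂ} {L : ℂ}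
    (hh : HasImproperIntegral h L) : improperIntegral h = L := hh.2.limUnder_eq

theorem ImproperConverges.hasImproperIntegral {h : ℝ → ℂ}
    (hh : ImproperConverges h) : HasImproperIntegral h (improperIntegral h) := by
  obtain ⟨L, hL⟩ := hh
  rwa [hL.improperIntegral_eq]

/-! ### Uniform tail estimates for Weyl integrals -/

theorem AntitoneOn.mul_of_nonneg {p q : ℝ → ℝ} {S : Set ℝ} (hp : AntitoneOn p S)
    (hq : AntitoneOn q S) (hp0 : ∀ x ∈ S, 0 ≤ p x) (hq0 : ∀ x ∈ S, 0 ≤ q x) :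
    AntitoneOn (fun x => p x * q x) S := fun x hx y hy hxy =>
  mul_le_mul (hp hx hy hxy) (hq hx hy hxy) (hq0 y hy) (hp0 x hx)

theorem monotoneOn_div_add {y N M : ℝ} (hy : 0 ≤ y) (hN : 0 < N) :
    MonotoneOn (fun u : ℝ => u / (y + u)) (Set.Icc N M) := by
  intro u hu v hv huv
  have hu0 : 0 < u := hN.trans_le hu.1
  have hv0 : 0 < v := hN.trans_le hv.1
  simp only
  rw [div_le_div_iff₀ (by positivity) (by positivity)]
  nlinarith

/-- The factor that turns the integrand `v ^ (α + σ - 1) g v`, at `v = y + u`, into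
`u ^ (α - 1) g (y + u)`. Of its two parts `(y + u) ^ (-σ)` decreases in `u`, and
`(u / (y + u)) ^ (α - 1)` is monotone and bounded for `u ≥ y`. -/
theorem weylIntegrand_weight_eq {α σ y u : ℝ} (hy : 0 ≤ y) (hu : 0 < u) :
    (y + u) ^ (-σ) * (u / (y + u)) ^ (α - 1) * (y + u) ^ (α + σ - 1) = u ^ (α - 1) := by
  have hyu : 0 < y + u := by positivity
  rw [Real.div_rpow hu.le hyu.le, show α + σ - 1 = σ + (α - 1) by ring, Real.rpow_add hyu,
    Real.rpow_neg hyu.le]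
  have h1 := (Real.rpow_pos_of_pos hyu σ).ne'
  have h2 := (Real.rpow_pos_of_pos hyu (α - 1)).ne'
  field_simp

/-- Convergence of `∫ v ^ (α + σ - 1) g v` makes the tails of `∫ u ^ (α - 1) g (y + u)` small,
uniformly for `y ∈ [0, Y]`. -/
theorem HasImproperIntegral.exists_weylIntegrand_tail_le {α σ : ℝ} (hσ : 0 < σ) {g : ℝ → ℂ}
    {L : ℂ} (hh : HasImproperIntegral (fun v => ((v ^ (α + σ - 1) : ℝ) : ℂ) * g v) L)
    (Y : ℝ) {ε : ℝ} (hε : 0 < ε) :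
    ∃ N₀ : ℝ, 0 < N₀ ∧ ∀ y ∈ Set.Icc 0 Y, ∀ N M : ℝ, N₀ ≤ N → N ≤ M →
      ‖∫ u in N..M, ((u ^ (α - 1) : ℝ) : ℂ) * g (y + u)‖ ≤ ε := by
  -- `(1 / 2) ^ (α - 1)` bounds the weight when `α ≤ 1`, as `u / (y + u) ≥ 1 / 2` for `u ≥ y`;
  -- the summand `2` serves the two weights used when `α ≥ 1`.
  set C : ℝ := 2 + (1 / 2 : ℝ) ^ (α - 1) with hC
  have hC0 : 0 < C := by positivity
  obtain ⟨N₁, hN₁, htail⟩ := hh.exists_norm_integral_le (div_pos hε hC0)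
  set δ := ε / C with hδ
  have hδ0 : 0 < δ := div_pos hε hC0
  refine ⟨max N₁ (max 1 Y), by positivity, fun y hy N M hN hNM => ?_⟩
  have hNN₁ : N₁ ≤ N := (le_max_left _ _).trans hN
  have hN1 : 1 ≤ N := ((le_max_left _ _).trans (le_max_right _ _)).trans hN
  have hNY : y ≤ N := (hy.2.trans ((le_max_right _ _).trans (le_max_right _ _))).trans hN
  have hy0 : 0 ≤ y := hy.1
  have hN0 : 0 < N := by linarith
  have hpos : ∀ u ∈ Set.Icc N M, 0 < u := fun u hu => hN0.trans_le hu.1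
  set h : ℝ → ℂ := fun v => ((v ^ (α + σ - 1) : ℝ) : ℂ) * g v with hdef
  have hHi : IntervalIntegrable (fun u => h (y + u)) volume N M := by
    have : IntervalIntegrable h volume (y + N) (y + M) :=
      (hh.1 (y + N) (by linarith)).symm.trans (hh.1 (y + M) (by linarith))
    simpa [add_comm y] using this.comp_add_left y
  have hHε : ∀ x ∈ Set.Icc N M, ‖∫ u in N..x, h (y + u)‖ ≤ δ := by
    intro x hx
    rw [intervalIntegral.integral_comp_add_left h y]
    exact htail _ _ (by linarith) (by linarith [hx.1])
  set p : ℝ → ℝ := fun u => (y + u) ^ (-σ) with hp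
  set q : ℝ → ℝ := fun u => (u / (y + u)) ^ (α - 1) with hq
  have hmono := monotoneOn_div_add (M := M) hy0 hN0
  have hratio : ∀ u ∈ Set.Icc N M, 0 < u / (y + u) := fun u hu =>
    div_pos (hpos u hu) (by linarith [hpos u hu])
  have hratio1 : ∀ u ∈ Set.Icc N M, u / (y + u) ≤ 1 := fun u hu => by
    rw [div_le_one (by linarith [hpos u hu])]; linarith
  have hp_anti : AntitoneOn p (Set.Icc N M) := fun u hu v hv huv =>
    Real.rpow_le_rpow_of_nonpos (by linarith [hpos u hu]) (by linarith) (by linarith)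
  have hp0 : ∀ u ∈ Set.Icc N M, 0 ≤ p u := fun u hu =>
    Real.rpow_nonneg (by linarith [hpos u hu]) _
  have hq0 : ∀ u ∈ Set.Icc N M, 0 ≤ q u := fun u hu => Real.rpow_nonneg (hratio u hu).le _
  have hNmem : N ∈ Set.Icc N M := ⟨le_rfl, hNM⟩
  have hpN : p N ≤ 1 := Real.rpow_le_one_of_one_le_of_nonpos (by linarith) (by linarith)
  have heq : ∫ u in N..M, ((u ^ (α - 1) : ℝ) : ℂ) * g (y + u) =
      ∫ u in N..M, ((p u * q u : ℝ) : ℂ) * h (y + u) := by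
    refine intervalIntegral.integral_congr fun u hu => ?_
    rw [Set.uIcc_of_le hNM] at hu
    simp only [hp, hq, hdef]
    rw [← weylIntegrand_weight_eq (α := α) (σ := σ) hy0 (hpos u hu)]
    push_cast
    ring
  rw [heq]
  have hCδ : C * δ = ε := mul_div_cancel₀ _ hC0.ne'
  rcases le_total α 1 with hα | hα
  · -- For `α ≤ 1` the whole weight decreases.
    have hq_anti : AntitoneOn q (Set.Icc N M) := fun u hu v hv huv =>
      Real.rpow_le_rpow_of_nonpos (hratio u hu) (hmono hu hv huv) (by linarith)
    have hqN : q N ≤ (1 / 2 : ℝ) ^ (α - 1) := by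
      refine Real.rpow_le_rpow_of_nonpos (by norm_num) ?_ (by linarith)
      rw [div_le_div_iff₀ (by norm_num) (by linarith)]
      linarith
    have hpq : p N * q N ≤ C := by
      have := mul_le_mul hpN hqN (hq0 N hNmem) zero_le_one
      linarith
    refine (norm_integral_antitoneOn_mul_le (w := fun u => p u * q u) hNM
      (hp_anti.mul_of_nonneg hq_anti hp0 hq0)
      (fun u hu => mul_nonneg (hp0 u hu) (hq0 u hu)) hHi hHε).trans ?_
    rw [← hCδ]
    exact mul_le_mul_of_nonneg_right hpq hδ0.le
  · -- For `α ≥ 1` it is the difference of the decreasing weights `p` and `p * (1 - q)`.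
    have hq1 : ∀ u ∈ Set.Icc N M, q u ≤ 1 := fun u hu =>
      Real.rpow_le_one (hratio u hu).le (hratio1 u hu) (by linarith)
    have hq_anti : AntitoneOn (fun u => 1 - q u) (Set.Icc N M) := fun u hu v hv huv => by
      have : q u ≤ q v :=
        Real.rpow_le_rpow (hratio u hu).le (hmono hu hv huv) (by linarith)
      simp only
      linarith
    have hpc : ContinuousOn p (Set.Icc N M) := by
      refine ContinuousOn.rpow_const (by fun_prop) fun u hu => Or.inl ?_
      linarith [hpos u hu]
    have hqc : ContinuousOn q (Set.Icc N M) := by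
      refine ContinuousOn.rpow_const (ContinuousOn.div (by fun_prop) (by fun_prop)
        fun u hu => ?_) fun u hu => Or.inl (hratio u hu).ne'
      linarith [hpos u hu]
    have hi : ∀ w : ℝ → ℝ, ContinuousOn w (Set.Icc N M) →
        IntervalIntegrable (fun u => ((w u : ℝ) : ℂ) * h (y + u)) volume N M := by
      intro w hw
      refine hHi.continuousOn_mul ?_
      rw [Set.uIcc_of_le hNM]
      exact Complex.continuous_ofReal.comp_continuousOn hw
    have hsplit : ∫ u in N..M, ((p u * q u : ℝ) : ℂ) * h (y + u) =
        (∫ u in N..M, ((p u : ℝ) : ℂ) * h (y + u)) -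
          ∫ u in N..M, ((p u * (1 - q u) : ℝ) : ℂ) * h (y + u) := by
      rw [← intervalIntegral.integral_sub (hi p hpc)
        (hi (fun u => p u * (1 - q u)) (hpc.mul (continuousOn_const.sub hqc)))]
      refine intervalIntegral.integral_congr fun u _ => ?_
      push_cast
      ring
    have hb1 := norm_integral_antitoneOn_mul_le hNM hp_anti hp0 hHi hHε
    have hb2 := norm_integral_antitoneOn_mul_le (w := fun u => p u * (1 - q u)) hNM
      (hp_anti.mul_of_nonneg hq_anti hp0 fun u hu => sub_nonneg.2 (hq1 u hu))
      (fun u hu => mul_nonneg (hp0 u hu) (sub_nonneg.2 (hq1 u hu))) hHi hHε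
    rw [hsplit]
    refine (norm_sub_le _ _).trans ((add_le_add hb1 hb2).trans ?_)
    have hpq : p N * (1 - q N) ≤ 1 :=
      mul_le_one₀ hpN (sub_nonneg.2 (hq1 N hNmem)) (by linarith [hq0 N hNmem])
    have hC2 : 2 ≤ C := by
      have : (0 : ℝ) ≤ (1 / 2 : ℝ) ^ (α - 1) := by positivity
      linarith
    calc p N * δ + p N * (1 - q N) * δ ≤ 2 * δ := by nlinarith
      _ ≤ C * δ := mul_le_mul_of_nonneg_right hC2 hδ0.le
      _ = ε := hCδ

theorem intervalIntegrable_rpow_mul {α : ℝ} (hα : 0 < α) {g : ℝ → ℂ} {R : ℝ} (hR : 0 ≤ R)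
    (hg : ContinuousOn g (Set.Icc 0 R)) :
    IntervalIntegrable (fun u => ((u ^ (α - 1) : ℝ) : ℂ) * g u) volume 0 R := by
  have : IntervalIntegrable (fun u : ℝ => ((u ^ (α - 1) : ℝ) : ℂ)) volume 0 R := by
    have h : IntervalIntegrable (fun u : ℝ => u ^ (α - 1)) volume 0 R :=
      intervalIntegral.intervalIntegrable_rpow' (by linarith)
    exact ⟨h.1.ofReal, h.2.ofReal⟩
  refine this.mul_continuousOn ?_
  rwa [Set.uIcc_of_le hR]

theorem HasImproperIntegral.improperConverges_shift {α σ : ℝ} (hα : 0 < α) (hσ : 0 < σ)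
    {g : ℝ → ℂ} (hg : ContinuousOn g (Set.Ici 0)) {L : ℂ}
    (hh : HasImproperIntegral (fun v => ((v ^ (α + σ - 1) : ℝ) : ℂ) * g v) L)
    {y : ℝ} (hy : 0 ≤ y) :
    ImproperConverges (fun u => ((u ^ (α - 1) : ℝ) : ℂ) * g (y + u)) := by
  refine improperConverges_of_tail (fun R hR => ?_) fun ε hε => ?_
  · refine intervalIntegrable_rpow_mul hα hR.le (hg.comp (by fun_prop) fun u hu => ?_)
    exact add_nonneg hy hu.1
  · obtain ⟨N₀, h0, hN⟩ := hh.exists_weylIntegrand_tail_le hσ y hε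
    exact ⟨N₀, h0, hN y ⟨hy, le_rfl⟩⟩

/-! ### Incomplete beta function and the truncated Fubini identity -/

/-- The incomplete beta function `∫_0^x t^(σ-1) (1-t)^(α-1) dt`. -/
noncomputable def incompleteBeta (σ α x : ℝ) : ℝ :=
  ∫ t in (0 : ℝ)..x, t ^ (σ - 1) * (1 - t) ^ (α - 1)

theorem ofReal_beta_integrand {σ α x : ℝ} (hx : x ∈ Set.Icc (0 : ℝ) 1) :
    (x : ℂ) ^ ((σ : ℂ) - 1) * (1 - (x : ℂ)) ^ ((α : ℂ) - 1) =
      ((x ^ (σ - 1) * (1 - x) ^ (α - 1) : ℝ) : ℂ) := by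
  rw [Complex.ofReal_mul, Complex.ofReal_cpow hx.1, Complex.ofReal_cpow (sub_nonneg.2 hx.2)]
  push_cast
  rfl

theorem intervalIntegrable_beta_integrand {σ α : ℝ} (hσ : 0 < σ) (hα : 0 < α) :
    IntervalIntegrable (fun t : ℝ => t ^ (σ - 1) * (1 - t) ^ (α - 1)) volume 0 1 := by
  have h := Complex.betaIntegral_convergent (u := (σ : ℂ)) (v := (α : ℂ)) (by simpa) (by simpa)
  rw [intervalIntegrable_iff_integrableOn_Ioc_of_le zero_le_one] at h ⊢
  refine (integrableOn_congr_fun (fun x hx => ?_) measurableSet_Ioc).1 h.re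
  rw [ofReal_beta_integrand ⟨hx.1.le, hx.2⟩]
  simp

theorem incompleteBeta_one {σ α : ℝ} (hσ : 0 < σ) (hα : 0 < α) :
    incompleteBeta σ α 1 = Real.Gamma σ * Real.Gamma α / Real.Gamma (σ + α) := by
  have h := ProbabilityTheory.beta_eq_betaIntegralReal σ α hσ hα
  rw [ProbabilityTheory.beta] at h
  rw [h, Complex.betaIntegral, intervalIntegral.integral_congr
    (g := fun x => ((x ^ (σ - 1) * (1 - x) ^ (α - 1) : ℝ) : ℂ)), intervalIntegral.integral_ofReal,
    Complex.ofReal_re, incompleteBeta]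
  intro x hx
  rw [Set.uIcc_of_le zero_le_one] at hx
  exact ofReal_beta_integrand hx

theorem incompleteBeta_mono {σ α x y : ℝ} (hσ : 0 < σ) (hα : 0 < α) (hx : 0 ≤ x) (hxy : x ≤ y)
    (hy : y ≤ 1) : incompleteBeta σ α x ≤ incompleteBeta σ α y := by
  refine intervalIntegral.integral_mono_interval le_rfl hx hxy ?_ ?_
  · refine (ae_restrict_mem measurableSet_Ioc).mono fun t ht => ?_
    exact mul_nonneg (Real.rpow_nonneg ht.1.le _) (Real.rpow_nonneg (by linarith [ht.2]) _)
  · refine (intervalIntegrable_beta_integrand hσ hα).mono_set ?_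
    rw [Set.uIcc_of_le (hx.trans hxy), Set.uIcc_of_le zero_le_one]
    exact Set.Icc_subset_Icc_right hy

theorem incompleteBeta_nonneg {σ α x : ℝ} (hσ : 0 < σ) (hα : 0 < α) (hx : 0 ≤ x) (hx1 : x ≤ 1) :
    0 ≤ incompleteBeta σ α x := by
  have h := incompleteBeta_mono hσ hα le_rfl hx hx1
  simpa [incompleteBeta] using h

theorem integral_rpow_mul_sub_rpow {σ α v c : ℝ} (hv : 0 < v) (hc : c ∈ Set.Icc 0 v) :
    ∫ y in (0 : ℝ)..c, y ^ (σ - 1) * (v - y) ^ (α - 1) =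
      v ^ (α + σ - 1) * incompleteBeta σ α (c / v) := by
  have h := intervalIntegral.integral_comp_mul_left
    (fun y : ℝ => y ^ (σ - 1) * (v - y) ^ (α - 1)) (a := 0) (b := c / v) hv.ne'
  rw [mul_zero, mul_div_cancel₀ _ hv.ne', smul_eq_mul, eq_inv_mul_iff_mul_eq₀ hv.ne'] at h
  rw [← h, incompleteBeta, ← intervalIntegral.integral_const_mul,
    ← intervalIntegral.integral_const_mul]
  refine intervalIntegral.integral_congr fun t ht => ?_
  rw [Set.uIcc_of_le (div_nonneg hc.1 hv.le)] at ht
  have ht1 : t ≤ 1 := ht.2.trans ((div_le_one hv).2 hc.2)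
  rw [show v - v * t = v * (1 - t) by ring, Real.mul_rpow hv.le ht.1,
    Real.mul_rpow hv.le (sub_nonneg.2 ht1), show α + σ - 1 = 1 + (σ - 1) + (α - 1) by ring,
    Real.rpow_add hv, Real.rpow_add hv, Real.rpow_one]
  ring

/-- Fubini's theorem for the truncated double integral over `0 < y ≤ Y`, `y ≤ v ≤ N`, `v = y + u`.
The inner integral over `y` is an incomplete beta function; the weight in `v` is the full beta
integral as long as `v ≤ Y`. -/
theorem integral_rpow_mul_weyl_swap {α σ Y N : ℝ} (hα : 0 < α) (hσ : 0 < σ) (hY : 0 < Y)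
    (hYN : Y ≤ N) {g : ℝ → ℂ} (hg : ContinuousOn g (Set.Ici 0)) :
    IntervalIntegrable (fun y => ((y ^ (σ - 1) : ℝ) : ℂ) *
      ∫ u in (0 : ℝ)..(N - y), ((u ^ (α - 1) : ℝ) : ℂ) * g (y + u)) volume 0 Y ∧
    ∫ y in (0 : ℝ)..Y, ((y ^ (σ - 1) : ℝ) : ℂ) *
        (∫ u in (0 : ℝ)..(N - y), ((u ^ (α - 1) : ℝ) : ℂ) * g (y + u)) =
      ∫ v in (0 : ℝ)..N, ((incompleteBeta σ α (min 1 (Y / v)) : ℝ) : ℂ) *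
        (((v ^ (α + σ - 1) : ℝ) : ℂ) * g v) ∧
    IntervalIntegrable (fun v => ((incompleteBeta σ α (min 1 (Y / v)) : ℝ) : ℂ) *
        (((v ^ (α + σ - 1) : ℝ) : ℂ) * g v)) volume 0 N := by
  have hN : 0 < N := hY.trans_le hYN
  set f : ℝ → ℝ := (Set.Ioc 0 Y).indicator fun y => y ^ (σ - 1) with hf
  -- The closed interval makes `y = v` admissible, so that the kernel in `y` is exactly the
  -- indicator of `(0, min v Y]`, whatever the value of `0 ^ (α - 1)`.
  set φ : ℝ → ℝ := (Set.Icc 0 N).indicator fun u => u ^ (α - 1) with hφ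
  set G : ℝ → ℂ := (Set.Ioc 0 N).indicator g with hG
  have hfi : Integrable f := by
    rw [hf, integrable_indicator_iff measurableSet_Ioc,
      ← intervalIntegrable_iff_integrableOn_Ioc_of_le hY.le]
    exact intervalIntegral.intervalIntegrable_rpow' (by linarith)
  have hφi : Integrable φ := by
    rw [hφ, integrable_indicator_iff measurableSet_Icc,
      ← intervalIntegrable_iff_integrableOn_Icc_of_le hN.le]
    exact intervalIntegral.intervalIntegrable_rpow' (by linarith)
  have hgN : ContinuousOn g (Set.Icc 0 N) := hg.mono fun x hx => hx.1
  obtain ⟨C, hC⟩ := isCompact_Icc.exists_bound_of_continuousOn hgN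
  have hGm : AEStronglyMeasurable G volume := by
    rw [hG, aestronglyMeasurable_indicator_iff measurableSet_Ioc]
    exact (hgN.mono Set.Ioc_subset_Icc_self).aestronglyMeasurable measurableSet_Ioc
  have hGb : ∀ v, ‖G v‖ ≤ max C 0 := by
    intro v
    by_cases hv : v ∈ Set.Ioc 0 N
    · rw [hG, Set.indicator_of_mem hv]
      exact (hC v ⟨hv.1.le, hv.2⟩).trans (le_max_left _ _)
    · rw [hG, Set.indicator_of_notMem hv]
      simp
  have hK : Integrable (fun p : ℝ × ℝ => ((f p.2 * φ (p.1 - p.2) : ℝ) : ℂ) * G p.1)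
      (volume.prod volume) := by
    have h1 := (hfi.convolution_integrand (ContinuousLinearMap.mul ℝ ℝ) hφi).ofReal (𝕜 := ℂ)
    exact h1.mul_bdd (c := max C 0) hGm.comp_fst (Filter.Eventually.of_forall fun p => hGb p.1)
  have hinner : ∀ y, ∫ v, ((f y * φ (v - y) : ℝ) : ℂ) * G v =
      (Set.Ioc 0 Y).indicator (fun y => ((y ^ (σ - 1) : ℝ) : ℂ) *
        ∫ u in (0 : ℝ)..(N - y), ((u ^ (α - 1) : ℝ) : ℂ) * g (y + u)) y := by
    intro y
    by_cases hy : y ∈ Set.Ioc 0 Y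
    swap
    · simp [hf, Set.indicator_of_notMem hy]
    rw [Set.indicator_of_mem hy, hf, Set.indicator_of_mem hy,
      intervalIntegral.integral_of_le (by linarith [hy.2]), ← integral_Icc_eq_integral_Ioc,
      ← integral_const_mul, ← integral_indicator measurableSet_Icc,
      ← integral_add_right_eq_self _ y]
    refine integral_congr_ae (Filter.Eventually.of_forall fun u => ?_)
    simp only [add_sub_cancel_right]
    by_cases hu : u ∈ Set.Icc 0 (N - y)
    · rw [Set.indicator_of_mem hu, hφ,
        Set.indicator_of_mem (show u ∈ Set.Icc 0 N from ⟨hu.1, by linarith [hu.2, hy.1]⟩), hG,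
        Set.indicator_of_mem (show u + y ∈ Set.Ioc 0 N from
          ⟨by linarith [hu.1, hy.1], by linarith [hu.2]⟩), add_comm u y]
      push_cast
      ring
    · rw [Set.indicator_of_notMem hu]
      by_cases hu0 : 0 ≤ u
      · have : u + y ∉ Set.Ioc 0 N := fun h => hu ⟨hu0, by linarith [h.2]⟩
        rw [hG, Set.indicator_of_notMem this, mul_zero]
      · have : u ∉ Set.Icc 0 N := fun h => hu0 h.1
        rw [hφ, Set.indicator_of_notMem this]
        simp
  have houter : ∀ v, ∫ y, ((f y * φ (v - y) : ℝ) : ℂ) * G v =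
      (Set.Ioc 0 N).indicator (fun v => ((incompleteBeta σ α (min 1 (Y / v)) : ℝ) : ℂ) *
        (((v ^ (α + σ - 1) : ℝ) : ℂ) * g v)) v := by
    intro v
    by_cases hv : v ∈ Set.Ioc 0 N
    swap
    · simp [hG, Set.indicator_of_notMem hv]
    have hv0 : 0 < v := hv.1
    have hmin : min v Y ∈ Set.Icc 0 v := ⟨le_min hv0.le hY.le, min_le_left _ _⟩
    have hconv : ∫ y, f y * φ (v - y) = v ^ (α + σ - 1) * incompleteBeta σ α (min 1 (Y / v)) := by
      have hdiv : min v Y / v = min 1 (Y / v) := by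
        rw [← min_div_div_right hv0.le, div_self hv0.ne']
      rw [← hdiv, ← integral_rpow_mul_sub_rpow hv0 hmin, intervalIntegral.integral_of_le hmin.1,
        ← integral_indicator measurableSet_Ioc]
      refine integral_congr_ae (Filter.Eventually.of_forall fun y => ?_)
      simp only
      by_cases hy : y ∈ Set.Ioc 0 (min v Y)
      · have h1 := hy.2.trans (min_le_left _ _)
        have h2 := hy.2.trans (min_le_right _ _)
        rw [Set.indicator_of_mem hy, hf, Set.indicator_of_mem (show y ∈ Set.Ioc 0 Y from ⟨hy.1, h2⟩),
          hφ, Set.indicator_of_mem (show v - y ∈ Set.Icc 0 N from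
            ⟨by linarith, by linarith [hy.1, hv.2]⟩)]
      · rw [Set.indicator_of_notMem hy]
        by_cases hy' : y ∈ Set.Ioc 0 Y
        · have : v - y ∉ Set.Icc 0 N := fun h =>
            hy ⟨hy'.1, le_min (by linarith [h.1]) hy'.2⟩
          rw [hφ, Set.indicator_of_notMem this, mul_zero]
        · rw [hf, Set.indicator_of_notMem hy', zero_mul]
    rw [integral_mul_const, integral_complex_ofReal, hconv, Set.indicator_of_mem hv, hG,
      Set.indicator_of_mem hv]
    push_cast
    ring
  refine ⟨?_, ?_, ?_⟩
  · rw [intervalIntegrable_iff_integrableOn_Ioc_of_le hY.le,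
      ← integrable_indicator_iff measurableSet_Ioc]
    exact hK.integral_prod_right.congr (Filter.Eventually.of_forall hinner)
  · have hswap := integral_integral_swap
      (f := fun v y => ((f y * φ (v - y) : ℝ) : ℂ) * G v) hK
    simp only [hinner, houter] at hswap
    rw [integral_indicator measurableSet_Ioc, integral_indicator measurableSet_Ioc,
      ← intervalIntegral.integral_of_le hY.le, ← intervalIntegral.integral_of_le hN.le] at hswap
    exact hswap.symm
  · rw [intervalIntegrable_iff_integrableOn_Ioc_of_le hN.le,
      ← integrable_indicator_iff measurableSet_Ioc]
    exact hK.integral_prod_left.congr (Filter.Eventually.of_forall houter)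

/-! ### Semigroup law for conditionally convergent Weyl integrals -/

theorem HasImproperIntegral.const_mul {h : ℝ → ℂ} {L : ℂ} (hh : HasImproperIntegral h L) (c : ℂ) :
    HasImproperIntegral (fun x => c * h x) (c * L) := by
  refine ⟨fun R hR => (hh.1 R hR).const_mul c, ?_⟩
  simpa only [intervalIntegral.integral_const_mul] using hh.2.const_mul c

theorem HasImproperIntegral.norm_sub_integral_le {h : ℝ → ℂ} {L : ℂ}
    (hh : HasImproperIntegral h L) {N ε : ℝ} (hN : 0 < N)
    (ht : ∀ M, N ≤ M → ‖∫ v in N..M, h v‖ ≤ ε) : ‖L - ∫ v in (0 : ℝ)..N, h v‖ ≤ ε := by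
  refine le_of_tendsto (hh.2.sub_const _).norm ?_
  filter_upwards [eventually_ge_atTop N] with M hM
  rw [intervalIntegral.integral_interval_sub_left (hh.1 M (hN.trans_le hM)) (hh.1 N hN)]
  exact ht M hM

/-- The error in replacing the weight `b(min 1 (Y/v))` by `b(1)` on `[0, Y]` and by `0` on
`[Y, N]`: on `[Y, N]` the weight decreases from `b(1)`. -/
theorem norm_integral_incompleteBeta_mul_sub_le {α σ Y N η : ℝ} (hα : 0 < α) (hσ : 0 < σ)
    (hY : 0 < Y) (hYN : Y ≤ N) {h : ℝ → ℂ}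
    (hb : IntervalIntegrable (fun v => ((incompleteBeta σ α (min 1 (Y / v)) : ℝ) : ℂ) * h v)
      volume 0 N)
    (hh : IntervalIntegrable h volume 0 N)
    (hη : ∀ M ∈ Set.Icc Y N, ‖∫ v in Y..M, h v‖ ≤ η) :
    ‖(∫ v in (0 : ℝ)..N, ((incompleteBeta σ α (min 1 (Y / v)) : ℝ) : ℂ) * h v) -
      ((incompleteBeta σ α 1 : ℝ) : ℂ) * ∫ v in (0 : ℝ)..Y, h v‖ ≤ incompleteBeta σ α 1 * η := by
  have hN : 0 < N := hY.trans_le hYN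
  have hYmem : Y ∈ Set.uIcc 0 N := by
    rw [Set.uIcc_of_le hN.le]
    exact ⟨hY.le, hYN⟩
  have hleft : ∫ v in (0 : ℝ)..Y, ((incompleteBeta σ α (min 1 (Y / v)) : ℝ) : ℂ) * h v =
      ((incompleteBeta σ α 1 : ℝ) : ℂ) * ∫ v in (0 : ℝ)..Y, h v := by
    rw [← intervalIntegral.integral_const_mul, intervalIntegral.integral_of_le hY.le,
      intervalIntegral.integral_of_le hY.le]
    refine setIntegral_congr_fun measurableSet_Ioc fun v hv => ?_
    rw [min_eq_left ((one_le_div hv.1).2 hv.2)]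
  have hdiv : ∀ v ∈ Set.Icc Y N, 0 ≤ min 1 (Y / v) := fun v hv =>
    le_min zero_le_one (div_nonneg hY.le (hY.le.trans hv.1))
  rw [← intervalIntegral.integral_add_adjacent_intervals
    (hb.mono_set (Set.uIcc_subset_uIcc Set.left_mem_uIcc hYmem))
    (hb.mono_set (Set.uIcc_subset_uIcc hYmem Set.right_mem_uIcc)), hleft, add_sub_cancel_left]
  refine (norm_integral_antitoneOn_mul_le (w := fun v => incompleteBeta σ α (min 1 (Y / v))) hYN
    (fun u hu v hv huv => incompleteBeta_mono hσ hα (hdiv v hv) (min_le_min le_rfl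
      (div_le_div_of_nonneg_left hY.le (hY.trans_le hu.1) huv)) (min_le_left _ _))
    (fun v hv => incompleteBeta_nonneg hσ hα (hdiv v hv) (min_le_left _ _))
    (hh.mono_set (Set.uIcc_subset_uIcc hYmem Set.right_mem_uIcc)) hη).trans_eq ?_
  simp [div_self hY.ne']

/-- Integrability against `y ^ (σ - 1)` passes to a uniform approximation, and so do the integrals
up to the corresponding error. -/
theorem intervalIntegrable_and_norm_integral_sub_le {σ Y ε : ℝ} (hσ : 0 < σ) (hY : 0 < Y)
    {W V : ℝ → ℂ}
    (hV : IntervalIntegrable (fun y => ((y ^ (σ - 1) : ℝ) : ℂ) * V y) volume 0 Y)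
    (hm : AEStronglyMeasurable (fun y => ((y ^ (σ - 1) : ℝ) : ℂ) * W y)
      (volume.restrict (Set.Ioc 0 Y)))
    (hWV : ∀ y ∈ Set.Ioc 0 Y, ‖W y - V y‖ ≤ ε) :
    IntervalIntegrable (fun y => ((y ^ (σ - 1) : ℝ) : ℂ) * W y) volume 0 Y ∧
    ‖(∫ y in (0 : ℝ)..Y, ((y ^ (σ - 1) : ℝ) : ℂ) * W y) -
      ∫ y in (0 : ℝ)..Y, ((y ^ (σ - 1) : ℝ) : ℂ) * V y‖ ≤
        ε * ∫ y in (0 : ℝ)..Y, y ^ (σ - 1) := by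
  have hp : IntervalIntegrable (fun y : ℝ => y ^ (σ - 1)) volume 0 Y :=
    intervalIntegral.intervalIntegrable_rpow' (by linarith)
  have hbound : ∀ y ∈ Set.Ioc 0 Y, ‖((y ^ (σ - 1) : ℝ) : ℂ) * W y - ((y ^ (σ - 1) : ℝ) : ℂ) * V y‖
      ≤ ε * y ^ (σ - 1) := fun y hy => by
    rw [← mul_sub, norm_mul, Complex.norm_real, Real.norm_of_nonneg (Real.rpow_nonneg hy.1.le _),
      mul_comm]
    exact mul_le_mul_of_nonneg_right (hWV y hy) (Real.rpow_nonneg hy.1.le _)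
  have hV' := (intervalIntegrable_iff_integrableOn_Ioc_of_le hY.le).1 hV
  have hp' := (intervalIntegrable_iff_integrableOn_Ioc_of_le hY.le).1 (hp.const_mul ε)
  have hdiff : IntegrableOn (fun y => ((y ^ (σ - 1) : ℝ) : ℂ) * W y -
      ((y ^ (σ - 1) : ℝ) : ℂ) * V y) (Set.Ioc 0 Y) :=
    Integrable.mono' hp' (hm.sub hV'.aestronglyMeasurable)
      ((ae_restrict_mem measurableSet_Ioc).mono hbound)
  have hW : IntervalIntegrable (fun y => ((y ^ (σ - 1) : ℝ) : ℂ) * W y) volume 0 Y := by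
    rw [intervalIntegrable_iff_integrableOn_Ioc_of_le hY.le]
    exact (hdiff.add hV').congr (Filter.Eventually.of_forall fun y => sub_add_cancel _ _)
  refine ⟨hW, ?_⟩
  rw [← intervalIntegral.integral_sub hW hV, ← intervalIntegral.integral_const_mul]
  refine intervalIntegral.norm_integral_le_of_norm_le hY.le ?_ (hp.const_mul ε)
  exact Filter.Eventually.of_forall hbound

/-- The semigroup law of the Weyl fractional integrals before normalisation, for conditionally
convergent integrals. -/
theorem HasImproperIntegral.rpow_mul_weyl {α σ : ℝ} (hα : 0 < α) (hσ : 0 < σ) {g : ℝ → ℂ}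
    (hg : ContinuousOn g (Set.Ici 0)) {L : ℂ}
    (hh : HasImproperIntegral (fun v => ((v ^ (α + σ - 1) : ℝ) : ℂ) * g v) L) :
    HasImproperIntegral (fun y => ((y ^ (σ - 1) : ℝ) : ℂ) *
        improperIntegral (fun u => ((u ^ (α - 1) : ℝ) : ℂ) * g (y + u)))
      (((incompleteBeta σ α 1 : ℝ) : ℂ) * L) := by
  set W : ℝ → ℂ := fun y => improperIntegral (fun u => ((u ^ (α - 1) : ℝ) : ℂ) * g (y + u))
  set V : ℝ → ℝ → ℂ := fun N y =>
    ∫ u in (0 : ℝ)..(N - y), ((u ^ (α - 1) : ℝ) : ℂ) * g (y + u) with hVdef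
  set B := incompleteBeta σ α 1
  have hB : 0 ≤ B := incompleteBeta_nonneg hσ hα zero_le_one le_rfl
  have hunif : ∀ Y ε : ℝ, 0 < ε → ∃ N₁ : ℝ, ∀ N, N₁ ≤ N → ∀ y ∈ Set.Ioc 0 Y,
      ‖W y - V N y‖ ≤ ε := by
    intro Y ε hε
    obtain ⟨N₀, hN₀, htail⟩ := hh.exists_weylIntegrand_tail_le hσ Y hε
    refine ⟨N₀ + Y, fun N hN y hy => ?_⟩
    have hNy : N₀ ≤ N - y := by linarith [hy.2]
    exact (hh.improperConverges_shift hα hσ hg hy.1.le).hasImproperIntegral.norm_sub_integral_le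
      (hN₀.trans_le hNy) fun M hM => htail y ⟨hy.1.le, hy.2⟩ _ _ hNy hM
  have hmeas : ∀ Y : ℝ, 0 < Y → AEStronglyMeasurable (fun y => ((y ^ (σ - 1) : ℝ) : ℂ) * W y)
      (volume.restrict (Set.Ioc 0 Y)) := by
    intro Y hY
    refine aestronglyMeasurable_of_tendsto_ae atTop
      (f := fun (n : ℕ) y => ((y ^ (σ - 1) : ℝ) : ℂ) * V (Y + n) y) (fun n => ?_) ?_
    · exact ((intervalIntegrable_iff_integrableOn_Ioc_of_le hY.le).1
        (integral_rpow_mul_weyl_swap hα hσ hY (by simp) hg).1).aestronglyMeasurable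
    · refine (ae_restrict_mem measurableSet_Ioc).mono fun y hy => Tendsto.const_mul _ ?_
      rw [Metric.tendsto_atTop]
      intro ε hε
      obtain ⟨N₁, hN₁⟩ := hunif Y (ε / 2) (half_pos hε)
      obtain ⟨n₀, hn₀⟩ := exists_nat_ge N₁
      refine ⟨n₀, fun n hn => ?_⟩
      rw [dist_comm, dist_eq_norm]
      have hnn : (n₀ : ℝ) ≤ n := by exact_mod_cast hn
      exact (hN₁ _ (by linarith) y hy).trans_lt (half_lt_self hε)
  have hint : ∀ Y : ℝ, 0 < Y →
      IntervalIntegrable (fun y => ((y ^ (σ - 1) : ℝ) : ℂ) * W y) volume 0 Y := by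
    intro Y hY
    obtain ⟨N₁, hN₁⟩ := hunif Y 1 one_pos
    exact (intervalIntegrable_and_norm_integral_sub_le hσ hY
      (integral_rpow_mul_weyl_swap hα hσ hY (le_max_right N₁ Y) hg).1 (hmeas Y hY)
      (hN₁ _ (le_max_left _ _))).1
  refine ⟨hint, ?_⟩
  have hest : ∀ η : ℝ, 0 < η → ∃ Y₀ : ℝ, 0 < Y₀ ∧ ∀ Y, Y₀ ≤ Y →
      ‖(∫ y in (0 : ℝ)..Y, ((y ^ (σ - 1) : ℝ) : ℂ) * W y) -
        (B : ℂ) * ∫ v in (0 : ℝ)..Y, ((v ^ (α + σ - 1) : ℝ) : ℂ) * g v‖ ≤ B * η := by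
    intro η hη
    obtain ⟨Y₀, hY₀, htail⟩ := hh.exists_norm_integral_le hη
    refine ⟨Y₀, hY₀, fun Y hYY₀ => ?_⟩
    have hY : 0 < Y := hY₀.trans_le hYY₀
    set D := ∫ y in (0 : ℝ)..Y, y ^ (σ - 1)
    have hD : 0 ≤ D := intervalIntegral.integral_nonneg hY.le fun y hy => Real.rpow_nonneg hy.1 _
    refine le_of_forall_pos_le_add fun ε hε => ?_
    obtain ⟨N₁, hN₁⟩ := hunif Y (ε / (D + 1)) (by positivity)
    obtain ⟨hVi, hVeq, hbi⟩ := integral_rpow_mul_weyl_swap hα hσ hY (le_max_right N₁ Y) hg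
    have h1 := (intervalIntegrable_and_norm_integral_sub_le hσ hY hVi (hmeas Y hY)
      (hN₁ _ (le_max_left _ _))).2
    rw [hVeq] at h1
    have h2 := norm_integral_incompleteBeta_mul_sub_le hα hσ hY (le_max_right N₁ Y) hbi
      (hh.1 _ (hY.trans_le (le_max_right _ _))) fun M hM => htail Y M hYY₀ hM.1
    have h3 : ε / (D + 1) * D ≤ ε := by
      rw [div_mul_eq_mul_div, div_le_iff₀ (by positivity)]
      nlinarith
    refine (norm_sub_le_norm_sub_add_norm_sub _ _ _).trans ((add_le_add h1 h2).trans ?_)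
    linarith
  have hdiff : Tendsto (fun Y : ℝ => (∫ y in (0 : ℝ)..Y, ((y ^ (σ - 1) : ℝ) : ℂ) * W y) -
      (B : ℂ) * ∫ v in (0 : ℝ)..Y, ((v ^ (α + σ - 1) : ℝ) : ℂ) * g v) atTop (𝓝 0) := by
    rw [Metric.tendsto_atTop]
    intro ε hε
    obtain ⟨Y₀, -, hY₀⟩ := hest (ε / (B + 1)) (by positivity)
    refine ⟨Y₀, fun Y hY => ?_⟩
    rw [dist_zero_right]
    refine (hY₀ Y hY).trans_lt ?_
    rw [mul_div_assoc', div_lt_iff₀ (by positivity)]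
    nlinarith
  simpa using hdiff.add (hh.2.const_mul (B : ℂ))

/-! ### Change of variables and integration by parts -/

/-- The substitution `y = x ^ k / k` in an improper integral. -/
theorem HasImproperIntegral.comp_rpow_div {s k : ℝ} (hk : 0 < k) {F : ℝ → ℂ} {L : ℂ}
    (hF : HasImproperIntegral (fun y => ((y ^ (s / k - 1) : ℝ) : ℂ) * F y) L) :
    HasImproperIntegral (fun x => ((x ^ (s - 1) : ℝ) : ℂ) * F (x ^ k / k))
      (((k ^ (s / k - 1) : ℝ) : ℂ) * L) := by
  set p : ℝ → ℝ := fun x => x ^ k / k with hp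
  set φ : ℝ → ℂ := fun y => ((y ^ (s / k - 1) : ℝ) : ℂ) * F y with hφ
  have hderiv : ∀ R : ℝ, ∀ x ∈ Set.Ioc 0 R,
      HasDerivWithinAt p (x ^ (k - 1)) (Set.Ioc 0 R) x := by
    intro R x hx
    have h := ((Real.hasDerivAt_rpow_const (p := k) (Or.inl hx.1.ne')).div_const k)
    rw [mul_div_cancel_left₀ _ hk.ne'] at h
    exact h.hasDerivWithinAt
  have hinj : ∀ R : ℝ, Set.InjOn p (Set.Ioc 0 R) := by
    intro R x hx y hy hxy
    have : x ^ k = y ^ k := by simpa [hp, div_left_inj' hk.ne'] using hxy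
    exact (Real.rpow_left_inj hx.1.le hy.1.le hk.ne').1 this
  have himage : ∀ R : ℝ, 0 < R → p '' Set.Ioc 0 R = Set.Ioc 0 (R ^ k / k) := by
    intro R hR
    ext y
    constructor
    · rintro ⟨x, hx, rfl⟩
      exact ⟨div_pos (Real.rpow_pos_of_pos hx.1 _) hk,
        div_le_div_of_nonneg_right (Real.rpow_le_rpow hx.1.le hx.2 hk.le) hk.le⟩
    · intro hy
      have hky : 0 < k * y := mul_pos hk hy.1
      refine ⟨(k * y) ^ k⁻¹, ⟨Real.rpow_pos_of_pos hky _, ?_⟩, ?_⟩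
      · rw [Real.rpow_inv_le_iff_of_pos hky.le hR.le hk]
        have := (le_div_iff₀ hk).1 hy.2
        linarith
      · simp only [hp]
        rw [Real.rpow_inv_rpow hky.le hk.ne', mul_div_cancel_left₀ _ hk.ne']
  have hpt : ∀ R : ℝ, Set.EqOn (fun x => |x ^ (k - 1)| • φ (p x))
      (fun x => (((k ^ (s / k - 1))⁻¹ : ℝ) : ℂ) * (((x ^ (s - 1) : ℝ) : ℂ) * F (x ^ k / k)))
      (Set.Ioc 0 R) := by
    intro R x hx
    -- The Jacobian `x ^ (k - 1)` times `(x ^ k / k) ^ (s / k - 1)` is `k ^ (1 - s / k) * x ^ (s - 1)`.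
    simp only [hφ, hp]
    rw [abs_of_nonneg (Real.rpow_nonneg hx.1.le _), Complex.real_smul, ← mul_assoc, ← mul_assoc,
      ← Complex.ofReal_mul, ← Complex.ofReal_mul, Real.div_rpow (Real.rpow_nonneg hx.1.le _) hk.le,
      ← Real.rpow_mul hx.1.le, mul_div_assoc', ← Real.rpow_add hx.1,
      show k - 1 + k * (s / k - 1) = s - 1 by field_simp; ring, div_eq_inv_mul]
  have hk0 : k ^ (s / k - 1) ≠ 0 := (Real.rpow_pos_of_pos hk _).ne'
  have hk1 : (((k ^ (s / k - 1))⁻¹ : ℝ) : ℂ) ≠ 0 := by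
    exact_mod_cast inv_ne_zero hk0
  have hint : ∀ R : ℝ, 0 < R →
      IntervalIntegrable (fun x => ((x ^ (s - 1) : ℝ) : ℂ) * F (x ^ k / k)) volume 0 R := by
    intro R hR
    have hRk : 0 < R ^ k / k := div_pos (Real.rpow_pos_of_pos hR _) hk
    have h := (intervalIntegrable_iff_integrableOn_Ioc_of_le hRk.le).1 (hF.1 _ hRk)
    rw [← himage R hR, integrableOn_image_iff_integrableOn_abs_deriv_smul measurableSet_Ioc
      (hderiv R) (hinj R), integrableOn_congr_fun (hpt R) measurableSet_Ioc] at h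
    rw [intervalIntegrable_iff_integrableOn_Ioc_of_le hR.le]
    have h2 := Integrable.const_mul h ((k ^ (s / k - 1) : ℝ) : ℂ)
    refine h2.congr (Filter.Eventually.of_forall fun x => ?_)
    simp only
    rw [← mul_assoc, ← Complex.ofReal_mul, mul_inv_cancel₀ hk0, Complex.ofReal_one, one_mul]
  refine ⟨hint, ?_⟩
  have hlim : Tendsto (fun R : ℝ => R ^ k / k) atTop atTop :=
    (tendsto_rpow_atTop hk).atTop_div_const hk
  refine ((hF.2.comp hlim).const_mul ((k ^ (s / k - 1) : ℝ) : ℂ)).congr' ?_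
  filter_upwards [eventually_gt_atTop 0] with R hR
  have hRk : 0 < R ^ k / k := div_pos (Real.rpow_pos_of_pos hR _) hk
  simp only [Function.comp]
  rw [intervalIntegral.integral_of_le hRk.le, intervalIntegral.integral_of_le hR.le,
    ← himage R hR, integral_image_eq_integral_abs_deriv_smul measurableSet_Ioc (hderiv R) (hinj R),
    setIntegral_congr_fun measurableSet_Ioc (hpt R), integral_const_mul, ← mul_assoc,
    ← Complex.ofReal_mul, mul_inv_cancel₀ hk0, Complex.ofReal_one, one_mul]

theorem integral_eq_sub_of_hasDerivAt_neg {g H : ℝ → ℂ} (hg : ContinuousOn g (Set.Ici 0))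
    (hH : ∀ u, 0 ≤ u → HasDerivAt H (-g u) u) {N M : ℝ} (hN : 0 ≤ N) (hNM : N ≤ M) :
    ∫ u in N..M, g u = H N - H M := by
  have hsub : Set.uIcc N M ⊆ Set.Ici 0 := by
    rw [Set.uIcc_of_le hNM]
    exact fun x hx => hN.trans hx.1
  have h := intervalIntegral.integral_eq_sub_of_hasDerivAt (f := fun u => -H u) (f' := g)
    (a := N) (b := M) (fun u hu => by
      have h := (hH u (hsub hu)).neg
      rw [neg_neg] at h
      exact h)
    (hg.mono hsub).intervalIntegrable
  rw [h]
  ring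

/-- If `H' = -g`, `H → 0` and `∫ v ^ (β - 1) g v` converges, then `H R = o(R ^ (1 - β))`: indeed
`H R = ∫_R^∞ v ^ (1 - β) * (v ^ (β - 1) g v) dv` has a decreasing weight. -/
theorem HasImproperIntegral.tendsto_rpow_mul_primitive {β : ℝ} (hβ : 1 ≤ β) {g H : ℝ → ℂ}
    (hg : ContinuousOn g (Set.Ici 0)) (hH : ∀ u, 0 ≤ u → HasDerivAt H (-g u) u)
    (hH0 : Tendsto H atTop (𝓝 0)) {L : ℂ}
    (hh : HasImproperIntegral (fun v => ((v ^ (β - 1) : ℝ) : ℂ) * g v) L) :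
    Tendsto (fun R : ℝ => ((R ^ (β - 1) : ℝ) : ℂ) * H R) atTop (𝓝 0) := by
  rw [Metric.tendsto_atTop]
  intro ε hε
  obtain ⟨N₀, hN₀, htail⟩ := hh.exists_norm_integral_le (half_pos hε)
  refine ⟨N₀, fun N hN => ?_⟩
  have hN0 : 0 < N := hN₀.trans_le hN
  have hbound : ∀ M, N ≤ M → ‖H N - H M‖ ≤ N ^ (1 - β) * (ε / 2) := by
    intro M hM
    have hpos : ∀ v ∈ Set.Icc N M, 0 < v := fun v hv => hN0.trans_le hv.1
    rw [← integral_eq_sub_of_hasDerivAt_neg hg hH hN0.le hM]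
    have heq : ∫ u in N..M, g u =
        ∫ u in N..M, ((u ^ (1 - β) : ℝ) : ℂ) * (((u ^ (β - 1) : ℝ) : ℂ) * g u) := by
      refine intervalIntegral.integral_congr fun u hu => ?_
      rw [Set.uIcc_of_le hM] at hu
      rw [← mul_assoc, ← Complex.ofReal_mul, ← Real.rpow_add (hpos u hu)]
      simp
    rw [heq]
    exact norm_integral_antitoneOn_mul_le hM
      (fun u hu v hv huv => Real.rpow_le_rpow_of_nonpos (hpos u hu) huv (by linarith))
      (fun u hu => Real.rpow_nonneg (hpos u hu).le _)
      ((hh.1 N hN0).symm.trans (hh.1 M (hN0.trans_le hM)))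
      (fun x hx => htail N x hN hx.1)
  have hHN : ‖H N‖ ≤ N ^ (1 - β) * (ε / 2) := by
    have hlim : Tendsto (fun M => ‖H N - H M‖) atTop (𝓝 ‖H N - 0‖) := (hH0.const_sub (H N)).norm
    rw [sub_zero] at hlim
    exact le_of_tendsto hlim ((eventually_ge_atTop N).mono hbound)
  rw [dist_zero_right, norm_mul, Complex.norm_real, Real.norm_of_nonneg (Real.rpow_nonneg hN0.le _)]
  calc N ^ (β - 1) * ‖H N‖ ≤ N ^ (β - 1) * (N ^ (1 - β) * (ε / 2)) :=
        mul_le_mul_of_nonneg_left hHN (Real.rpow_nonneg hN0.le _)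
    _ = ε / 2 := by
        rw [← mul_assoc, ← Real.rpow_add hN0]
        simp
    _ < ε := half_lt_self hε

theorem HasImproperIntegral.eq_of_hasDerivAt_neg {g H : ℝ → ℂ}
    (hg : ContinuousOn g (Set.Ici 0)) (hH : ∀ u, 0 ≤ u → HasDerivAt H (-g u) u)
    (hH0 : Tendsto H atTop (𝓝 0)) {L : ℂ} (hh : HasImproperIntegral g L) : L = H 0 := by
  refine tendsto_nhds_unique hh.2 ?_
  have hlim : Tendsto (fun M => H 0 - H M) atTop (𝓝 (H 0 - 0)) := hH0.const_sub _
  rw [sub_zero] at hlim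
  refine hlim.congr' ?_
  filter_upwards [eventually_ge_atTop 0] with R hR
  rw [integral_eq_sub_of_hasDerivAt_neg hg hH le_rfl hR]

/-- Integration by parts lowering the exponent by one, for `β > 1`. -/
theorem HasImproperIntegral.rpow_mul_primitive {β : ℝ} (hβ : 1 < β) {g H : ℝ → ℂ}
    (hg : ContinuousOn g (Set.Ici 0)) (hH : ∀ u, 0 ≤ u → HasDerivAt H (-g u) u)
    (hH0 : Tendsto H atTop (𝓝 0)) {L : ℂ}
    (hh : HasImproperIntegral (fun v => ((v ^ (β - 1) : ℝ) : ℂ) * g v) L) :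
    HasImproperIntegral (fun v => ((v ^ (β - 1 - 1) : ℝ) : ℂ) * H v)
      (((β - 1 : ℝ) : ℂ)⁻¹ * L) := by
  have hβ1 : 0 < β - 1 := by linarith
  have hβ0 : ((β - 1 : ℝ) : ℂ) ≠ 0 := by exact_mod_cast hβ1.ne'
  have hHc : ∀ R : ℝ, ContinuousOn H (Set.Icc 0 R) := fun R u hu =>
    (hH u hu.1).continuousAt.continuousWithinAt
  have hint : ∀ R : ℝ, 0 < R →
      IntervalIntegrable (fun v => ((v ^ (β - 1 - 1) : ℝ) : ℂ) * H v) volume 0 R := fun R hR =>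
    intervalIntegrable_rpow_mul hβ1 hR.le (hHc R)
  refine ⟨hint, ?_⟩
  have hdecay := hh.tendsto_rpow_mul_primitive hβ.le hg hH hH0
  have hlim := (hdecay.add hh.2).const_mul (((β - 1 : ℝ) : ℂ)⁻¹)
  rw [zero_add] at hlim
  refine hlim.congr' ?_
  filter_upwards [eventually_gt_atTop 0] with R hR
  have hi2 := (hint R hR).const_mul ((β - 1 : ℝ) : ℂ)
  have hparts := intervalIntegral.integral_eq_sub_of_hasDerivAt_of_le
    (f := fun u : ℝ => ((u ^ (β - 1) : ℝ) : ℂ) * H u)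
    (f' := fun u => ((β - 1 : ℝ) : ℂ) * (((u ^ (β - 1 - 1) : ℝ) : ℂ) * H u) -
      ((u ^ (β - 1) : ℝ) : ℂ) * g u) hR.le ?_ ?_ (hi2.sub (hh.1 R hR))
  · rw [intervalIntegral.integral_sub hi2 (hh.1 R hR), intervalIntegral.integral_const_mul,
      Real.zero_rpow hβ1.ne', Complex.ofReal_zero, zero_mul, sub_zero, sub_eq_iff_eq_add] at hparts
    rw [← hparts, inv_mul_cancel_left₀ hβ0]
  · refine ContinuousOn.mul (Complex.continuous_ofReal.comp_continuousOn ?_) (hHc R)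
    exact (Real.continuous_rpow_const hβ1.le).continuousOn
  · intro u hu
    have h1 := (Real.hasDerivAt_rpow_const (p := β - 1) (Or.inl hu.1.ne')).ofReal_comp
    have hval : ((β - 1 : ℝ) : ℂ) * (((u ^ (β - 1 - 1) : ℝ) : ℂ) * H u) -
        ((u ^ (β - 1) : ℝ) : ℂ) * g u =
        (((β - 1) * u ^ (β - 1 - 1) : ℝ) : ℂ) * H u + ((u ^ (β - 1) : ℝ) : ℂ) * -g u := by
      rw [Complex.ofReal_mul]
      ring
    simp only [hval]
    exact h1.mul (hH u hu.1.le)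

/-! ### Fractional derivatives -/

theorem ContDiffAt.continuousAt_iteratedDeriv {f : ℝ → ℂ} {n j : ℕ} {t : ℝ}
    (hf : ContDiffAt ℝ n f t) (hj : j ≤ n) : ContinuousAt (iteratedDeriv j f) t := by
  rw [iteratedDeriv_eq_equiv_comp]
  exact (LinearIsometryEquiv.continuous _).continuousAt.comp
    (hf.continuousAt_iteratedFDeriv (by exact_mod_cast hj))

theorem ContDiffAt.hasDerivAt_iteratedDeriv {f : ℝ → ℂ} {n j : ℕ} {t : ℝ}
    (hf : ContDiffAt ℝ n f t) (hj : j < n) :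
    HasDerivAt (iteratedDeriv j f) (iteratedDeriv (j + 1) f t) t := by
  have h : DifferentiableAt ℝ (iteratedDeriv j f) t := by
    rw [iteratedDeriv_eq_equiv_comp]
    exact (LinearIsometryEquiv.differentiable _).differentiableAt.comp t
      (hf.differentiableAt_iteratedFDeriv (by exact_mod_cast hj))
  rw [iteratedDeriv_succ]
  exact h.hasDerivAt

theorem continuousOn_iteratedDeriv_reflect {f : ℝ → ℂ} {n j : ℕ} {a : ℝ}
    (hf : ∀ t : ℝ, t ≤ a → ContDiffAt ℝ n f t) (hj : j ≤ n) :
    ContinuousOn (fun u => iteratedDeriv j f (a - u)) (Set.Ici 0) := fun u hu =>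
  (ContinuousAt.comp (f := fun u => a - u) (g := iteratedDeriv j f)
    ((hf (a - u) (sub_le_self a hu)).continuousAt_iteratedDeriv hj)
    (by fun_prop)).continuousWithinAt

theorem hasDerivAt_iteratedDeriv_reflect {f : ℝ → ℂ} {n j : ℕ} {a : ℝ}
    (hf : ∀ t : ℝ, t ≤ a → ContDiffAt ℝ n f t) (hj : j < n) {u : ℝ} (hu : 0 ≤ u) :
    HasDerivAt (fun u => iteratedDeriv j f (a - u)) (-iteratedDeriv (j + 1) f (a - u)) u :=
  ((hf (a - u) (sub_le_self a hu)).hasDerivAt_iteratedDeriv hj).comp_const_sub a u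

theorem weylIntegral_of_ne_zero {α : ℝ} (hα : α ≠ 0) (G : ℝ → ℂ) (t : ℝ) :
    weylIntegral α G t = ((Real.Gamma α : ℝ) : ℂ)⁻¹ * improperIntegral (weylIntegrand α G t) :=
  if_neg hα

theorem weylIntegral_zero (G : ℝ → ℂ) (t : ℝ) : weylIntegral 0 G t = G t := if_pos rfl

/-- One integration by parts: the fractional integral of order `γ + 1` of `f⁽ʲ⁺¹⁾` is the one of
order `γ` of `f⁽ʲ⁾`. For `γ = 0` this is the fundamental theorem of calculus. -/
theorem weylIntegral_iteratedDeriv_succ {f : ℝ → ℂ} {n j : ℕ} {a : ℝ}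
    (hf : ∀ t : ℝ, t ≤ a → ContDiffAt ℝ n f t) (hj : j < n)
    (hdecay : Tendsto (iteratedDeriv j f) atBot (𝓝 0)) {γ : ℝ} (hγ : 0 ≤ γ)
    (hconv : ImproperConverges (weylIntegrand (γ + 1) (iteratedDeriv (j + 1) f) a)) :
    (γ = 0 ∨ ImproperConverges (weylIntegrand γ (iteratedDeriv j f) a)) ∧
      weylIntegral γ (iteratedDeriv j f) a =
        weylIntegral (γ + 1) (iteratedDeriv (j + 1) f) a := by
  have hg := continuousOn_iteratedDeriv_reflect hf (Nat.succ_le_of_lt hj)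
  have hH := fun u (hu : 0 ≤ u) => hasDerivAt_iteratedDeriv_reflect hf hj hu
  have hH0 : Tendsto (fun u => iteratedDeriv j f (a - u)) atTop (𝓝 0) :=
    hdecay.comp (tendsto_atBot_mono (fun u => (sub_eq_add_neg a u).le)
      (tendsto_atBot_add_const_left _ a tendsto_neg_atTop_atBot))
  have hL := hconv.hasImproperIntegral
  rcases hγ.eq_or_lt with rfl | hγ
  · refine ⟨Or.inl rfl, ?_⟩
    have heq : weylIntegrand (0 + 1) (iteratedDeriv (j + 1) f) a =
        fun u => iteratedDeriv (j + 1) f (a - u) := by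
      funext u
      simp [weylIntegrand]
    rw [heq] at hL
    rw [weylIntegral_zero, weylIntegral_of_ne_zero (by norm_num), heq,
      hL.eq_of_hasDerivAt_neg hg hH hH0]
    simp
  · have h := HasImproperIntegral.rpow_mul_primitive (β := γ + 1) (by linarith) hg hH hH0 hL
    have heq : (fun v => ((v ^ (γ + 1 - 1 - 1) : ℝ) : ℂ) * iteratedDeriv j f (a - v)) =
        weylIntegrand γ (iteratedDeriv j f) a := by
      funext u
      simp [weylIntegrand]
    rw [heq, add_sub_cancel_right] at h
    refine ⟨Or.inr ⟨_, h⟩, ?_⟩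
    rw [weylIntegral_of_ne_zero hγ.ne', weylIntegral_of_ne_zero (by linarith),
      h.improperIntegral_eq, Real.Gamma_add_one hγ.ne', Complex.ofReal_mul, mul_inv]
    ring

/-- The fractional derivative of order `ρ` may be computed from any ordinary derivative of order
`n ≥ ⌈ρ⌉₊`, provided that the lower ones vanish at `-∞`. -/
theorem fracDeriv_eq_weylIntegral_of_le {f : ℝ → ℂ} {n : ℕ} {a ρ : ℝ}
    (hf : ∀ t : ℝ, t ≤ a → ContDiffAt ℝ n f t) (hn : ⌈ρ⌉₊ ≤ n) (hρ : ρ < n)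
    (hconv : ImproperConverges (weylIntegrand (n - ρ) (iteratedDeriv n f) a))
    (hdecay : ∀ j : ℕ, ⌈ρ⌉₊ ≤ j → j < n → Tendsto (iteratedDeriv j f) atBot (𝓝 0)) :
    FracDerivConverges ρ f a ∧
      fracDeriv ρ f a = weylIntegral (n - ρ) (iteratedDeriv n f) a := by
  have key : ∀ i j : ℕ, j + i = n → ⌈ρ⌉₊ ≤ j →
      ((j : ℝ) - ρ = 0 ∨ ImproperConverges (weylIntegrand (j - ρ) (iteratedDeriv j f) a)) ∧
        weylIntegral (j - ρ) (iteratedDeriv j f) a =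
          weylIntegral (n - ρ) (iteratedDeriv n f) a := by
    intro i
    induction i with
    | zero =>
      rintro j rfl -
      exact ⟨Or.inr hconv, rfl⟩
    | succ i ih =>
      intro j hj hmj
      have hργ : 0 ≤ (j : ℝ) - ρ := sub_nonneg.2 (Nat.ceil_le.1 hmj)
      have hcast : ((j + 1 : ℕ) : ℝ) - ρ = (j : ℝ) - ρ + 1 := by
        push_cast
        ring
      obtain ⟨h1, h2⟩ := ih (j + 1) (by omega) (by omega)
      rw [hcast] at h1 h2
      obtain ⟨h3, h4⟩ := weylIntegral_iteratedDeriv_succ hf (by omega) (hdecay j hmj (by omega))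
        hργ (h1.resolve_left (by linarith))
      exact ⟨h3, h4.trans h2⟩
  exact key (n - ⌈ρ⌉₊) ⌈ρ⌉₊ (by omega) le_rfl

/-- The semigroup law `W_σ W_α = W_(α+σ)` at the point `a`, including the case `α = 0`, together
with the existence of `W_α` on `(-∞, a]`. -/
theorem hasImproperIntegral_rpow_mul_weylIntegral {α σ a : ℝ} (hα : 0 ≤ α) (hσ : 0 < σ)
    {G : ℝ → ℂ} (hG : ContinuousOn (fun u => G (a - u)) (Set.Ici 0))
    (hconv : ImproperConverges (weylIntegrand (α + σ) G a)) :
    (∀ t : ℝ, t ≤ a → α = 0 ∨ ImproperConverges (weylIntegrand α G t)) ∧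
      HasImproperIntegral (fun y => ((y ^ (σ - 1) : ℝ) : ℂ) * weylIntegral α G (a - y))
        (((Real.Gamma σ : ℝ) : ℂ) * weylIntegral (α + σ) G a) := by
  have hL := hconv.hasImproperIntegral
  have hΓ : ∀ x : ℝ, 0 < x → ((Real.Gamma x : ℝ) : ℂ) ≠ 0 := fun x hx => by
    exact_mod_cast (Real.Gamma_pos_of_pos hx).ne'
  rw [weylIntegral_of_ne_zero (by linarith : α + σ ≠ 0)]
  rcases hα.eq_or_lt with rfl | hα
  · refine ⟨fun _ _ => Or.inl rfl, ?_⟩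
    simp only [weylIntegral_zero]
    rw [zero_add] at hL ⊢
    rw [mul_inv_cancel_left₀ (hΓ σ hσ)]
    exact hL
  · have hshift : ∀ y, weylIntegrand α G (a - y) =
        fun u => ((u ^ (α - 1) : ℝ) : ℂ) * (fun v => G (a - v)) (y + u) := by
      intro y
      funext u
      simp only [weylIntegrand, sub_sub]
    constructor
    · intro t ht
      have h := HasImproperIntegral.improperConverges_shift hα hσ hG hL (sub_nonneg.2 ht)
      rw [← hshift, sub_sub_cancel] at h
      exact Or.inr h
    · have h := (HasImproperIntegral.rpow_mul_weyl hα hσ hG hL).const_mul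
        ((Real.Gamma α : ℝ) : ℂ)⁻¹
      simp only [← hshift] at h
      rw [incompleteBeta_one hσ hα, add_comm σ α] at h
      convert h using 1
      · funext y
        rw [weylIntegral_of_ne_zero hα.ne']
        ring
      · have h1 := hΓ α hα
        push_cast
        field_simp

theorem theorem2p3 (r s k a : ℝ) (hs : 0 < s) (hk : 0 < k) (f : ℝ → ℂ)
    (hf : ∀ t : ℝ, t ≤ a → ContDiffAt ℝ (⌈r⌉₊ : ℕ) f t)
    (hconv : ImproperConverges
      (fun u : ℝ => ((u ^ ((⌈r⌉₊ : ℝ) - r + s / k - 1) : ℝ) : ℂ) * iteratedDeriv ⌈r⌉₊ f (a - u)))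
    (hdecay : ∀ j : ℕ, ⌈r - s / k⌉₊ ≤ j → j < ⌈r⌉₊ →
      Tendsto (iteratedDeriv j f) atBot (𝓝 0)) :
    (∀ t : ℝ, t ≤ a → FracDerivConverges r f t) ∧
    FracDerivConverges (r - s / k) f a ∧
    HasImproperIntegral
      (fun x : ℝ => ((x ^ (s - 1) : ℝ) : ℂ) * fracDeriv r f (a - x ^ k / k))
      (((k ^ (s / k - 1) * Real.Gamma (s / k) : ℝ) : ℂ) * fracDeriv (r - s / k) f a) := by
  have hσ : 0 < s / k := div_pos hs hk
  have hα : 0 ≤ (⌈r⌉₊ : ℝ) - r := sub_nonneg.2 (Nat.le_ceil r)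
  have hexp : (⌈r⌉₊ : ℝ) - (r - s / k) = (⌈r⌉₊ : ℝ) - r + s / k := by ring
  have hconv' : ImproperConverges
      (weylIntegrand ((⌈r⌉₊ : ℝ) - r + s / k) (iteratedDeriv ⌈r⌉₊ f) a) := hconv
  obtain ⟨hexists, hsemi⟩ := hasImproperIntegral_rpow_mul_weylIntegral hα hσ
    (continuousOn_iteratedDeriv_reflect hf le_rfl) hconv'
  obtain ⟨hfrac, hval⟩ := fracDeriv_eq_weylIntegral_of_le (ρ := r - s / k) hf
    (Nat.ceil_mono (sub_le_self r hσ.le)) (by linarith) (hexp ▸ hconv') hdecay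
  refine ⟨hexists, hfrac, ?_⟩
  rw [hval, hexp, Complex.ofReal_mul, mul_assoc]
  exact HasImproperIntegral.comp_rpow_div (F := fun y => fracDeriv r f (a - y)) hk hsemi
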